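/- Let $\Bbbk$ be a field of characteristic $p>0$ and let $H$ be a finite-dimensional pointed Hopf algebra over $\Bbbk$, i.e. every simple subcoalgebra of $H$ is one-dimensional. Let $H_0$ be the coradical of $H$ (the sum of all simple subcoalgebras), which is a sub-bialgebra of $H$, and let $H_0\subseteq H_1\subseteq H_2\subseteq\cdots$ be the coradical filtration, $H_{m+1}=\Delta^{-1}(H_0\otimes H+H\otimes H_m)$. For a bialgebra $B$ with unit map $u$ and counit $\varepsilon$, let $\exp(B)$ be the least positive integer $m$ such that the $m$-th Hopf power map $[m]\colon b\mapsto\sum b_{(1)}b_{(2)}\cdots b_{(m)}$ equals $u\circ\varepsilon$, and $\exp(B)=\infty$ if no such $m$ exists. Assume that $H=H_n$ for some positive integer $n$. Then $d=\exp(H_0)$ is finite and $$\exp(H)\le d\,p^{\lfloor\log_p n\rfloor+1};$$ in particular $\exp(H)$ is finite. -/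

import Mathlib

open scoped TensorProduct

noncomputable section

namespace PointedHopf

section Coalgebra

variable (k : Type*) {C : Type*} [Field k] [AddCommGroup C] [Module k C]

/-- The subspace `U ⊗ V` of `C ⊗ C` attached to subspaces `U`, `V` of `C`. -/
def tensorSub (U V : Submodule k C) : Submodule k (C ⊗[k] C) :=
  LinearMap.range (TensorProduct.map U.subtype V.subtype)

variable [Coalgebra k C]

/-- A subspace `D` is a subcoalgebra if `Δ(D) ⊆ D ⊗ D`. -/
def IsSubcoalgebra (D : Submodule k C) : Prop :=
  ∀ x ∈ D, Coalgebra.comul x ∈ tensorSub k D D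

/-- A simple subcoalgebra: a nonzero subcoalgebra whose only subcoalgebras are `0` and itself. -/
def IsSimpleSubcoalgebra (D : Submodule k C) : Prop :=
  IsSubcoalgebra k D ∧ D ≠ ⊥ ∧ ∀ E : Submodule k C, E ≤ D → IsSubcoalgebra k E → E = ⊥ ∨ E = D

variable (C) in
/-- The coradical `C₀`: the sum of all simple subcoalgebras. -/
def coradical : Submodule k C :=
  sSup {D | IsSimpleSubcoalgebra k D}

/-- The wedge `U ∧ V = Δ⁻¹(U ⊗ C + C ⊗ V)`. -/
def wedge (U V : Submodule k C) : Submodule k C :=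
  (tensorSub k U ⊤ ⊔ tensorSub k ⊤ V).comap Coalgebra.comul

variable (C) in
/-- The coradical filtration: `C₀` is the coradical and
`Cₙ₊₁ = C₀ ∧ Cₙ = Δ⁻¹(C₀ ⊗ C + C ⊗ Cₙ)`. -/
def coradicalFiltration : ℕ → Submodule k C
  | 0 => coradical k C
  | n + 1 => wedge k (coradical k C) (coradicalFiltration n)

variable (C) in
/-- A coalgebra is pointed if all its simple subcoalgebras are one-dimensional. -/
def IsPointed : Prop :=
  ∀ D : Submodule k C, IsSimpleSubcoalgebra k D → Module.finrank k D = 1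

end Coalgebra

section HopfPower

variable (k H : Type*) [Field k] [Ring H] [Bialgebra k H]

/-- The iterated comultiplication `Δₙ : H → H^{⊗ n}`, `h ↦ ∑ h₍₁₎ ⊗ ⋯ ⊗ h₍ₙ₎`:
`Δ₀` is the counit and `Δₙ₊₁ = (Δₙ ⊗ id) ∘ Δ`. -/
def iterComul : (n : ℕ) → H →ₗ[k] ⨂[k]^n H
  | 0 => (PiTensorProduct.isEmptyEquiv (Fin 0)).symm.toLinearMap ∘ₗ Coalgebra.counit
  | n + 1 => (TensorPower.mulEquiv (n := n) (m := 1)).toLinearMap ∘ₗ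
      TensorProduct.map (iterComul n)
        (PiTensorProduct.subsingletonEquiv (0 : Fin 1)).symm.toLinearMap ∘ₗ Coalgebra.comul

/-- The iterated multiplication `mₙ : H^{⊗ n} → H`, `h₁ ⊗ ⋯ ⊗ hₙ ↦ h₁ ⋯ hₙ`. -/
def iterMul (n : ℕ) : (⨂[k]^n H) →ₗ[k] H :=
  PiTensorProduct.lift (MultilinearMap.mkPiAlgebraFin k n H)

/-- The `n`-th Hopf power map `[n] = mₙ ∘ Δₙ`. -/
def hopfPower (n : ℕ) : H →ₗ[k] H :=
  iterMul k H n ∘ₗ iterComul k H n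

/-- The `n`-th Hopf power is trivial on all of `H`: `h^{[n]} = ε(h) 1` for every `h`. -/
def HopfPowerTrivial (n : ℕ) : Prop :=
  ∀ h : H, hopfPower k H n h = algebraMap k H (Coalgebra.counit h)

/-- The exponent of a bialgebra: the least positive `n` whose Hopf power is trivial,
and `⊤` if there is none. -/
def hopfExponent : ℕ∞ :=
  ⨅ (n : ℕ) (_ : 0 < n ∧ HopfPowerTrivial k H n), (n : ℕ∞)

end HopfPower

section SubBialgebra

variable {k C : Type*} [Field k] [AddCommGroup C] [Module k C]

lemma tensorSub_mono {U U' V V' : Submodule k C} (hU : U ≤ U') (hV : V ≤ V') :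
    tensorSub k U V ≤ tensorSub k U' V' := by
  rintro _ ⟨t, rfl⟩
  refine ⟨TensorProduct.map (Submodule.inclusion hU) (Submodule.inclusion hV) t, ?_⟩
  rw [← LinearMap.comp_apply, ← TensorProduct.map_comp]
  rfl

lemma map_subtype_injective (D : Submodule k C) :
    Function.Injective (TensorProduct.map D.subtype D.subtype) :=
  TensorProduct.map_injective_of_flat_flat _ _ D.injective_subtype D.injective_subtype

variable [Coalgebra k C]

/-- The restriction `D → D ⊗ D` of the comultiplication to a subcoalgebra `D`. -/
def IsSubcoalgebra.comulRestrict {D : Submodule k C} (hD : IsSubcoalgebra k D) :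
    D →ₗ[k] D ⊗[k] D :=
  (LinearEquiv.ofInjective _ (map_subtype_injective D)).symm.toLinearMap ∘ₗ
    (Coalgebra.comul.restrict hD)

lemma IsSubcoalgebra.map_comulRestrict {D : Submodule k C} (hD : IsSubcoalgebra k D) (x : D) :
    TensorProduct.map D.subtype D.subtype (hD.comulRestrict x) = Coalgebra.comul (x : C) := by
  have h := LinearEquiv.apply_symm_apply
    (LinearEquiv.ofInjective _ (map_subtype_injective D)) (Coalgebra.comul.restrict hD x)
  exact congrArg Subtype.val h

/-- A subcoalgebra is a coalgebra with the restricted comultiplication and counit. -/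
abbrev IsSubcoalgebra.coalgebra {D : Submodule k C} (hD : IsSubcoalgebra k D) :
    Coalgebra k D where
  comul := hD.comulRestrict
  counit := Coalgebra.counit ∘ₗ D.subtype
  coassoc := by
    have hc : TensorProduct.map D.subtype D.subtype ∘ₗ hD.comulRestrict =
        Coalgebra.comul ∘ₗ D.subtype := LinearMap.ext hD.map_comulRestrict
    have hinj : Function.Injective
        (TensorProduct.map D.subtype (TensorProduct.map D.subtype D.subtype)) :=
      TensorProduct.map_injective_of_flat_flat _ _ D.injective_subtype (map_subtype_injective D)
    ext x
    apply hinj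
    have h1 : ∀ t : D ⊗[k] D,
        TensorProduct.map D.subtype (TensorProduct.map D.subtype D.subtype)
          (TensorProduct.assoc k D D D (hD.comulRestrict.rTensor D t)) =
        TensorProduct.assoc k C C C (Coalgebra.comul.rTensor C
          (TensorProduct.map D.subtype D.subtype t)) := by
      intro t
      induction t with
      | zero => simp
      | add a b ha hb => simp only [map_add, ha, hb]
      | tmul a b =>
        have := hD.map_comulRestrict a
        simp only [LinearMap.rTensor_tmul, TensorProduct.map_tmul, Submodule.subtype_apply,
          ← this]
        generalize hD.comulRestrict a = s
        induction s with
        | zero => simp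
        | add a b ha hb => simp only [map_add, TensorProduct.add_tmul, ha, hb]
        | tmul a b => simp
    have h2 : ∀ t : D ⊗[k] D,
        TensorProduct.map D.subtype (TensorProduct.map D.subtype D.subtype)
          (hD.comulRestrict.lTensor D t) =
        Coalgebra.comul.lTensor C (TensorProduct.map D.subtype D.subtype t) := by
      intro t
      induction t with
      | zero => simp
      | add a b ha hb => simp only [map_add, ha, hb]
      | tmul a b => simp [hD.map_comulRestrict b]
    simp only [LinearMap.comp_apply, LinearEquiv.coe_coe, h1, h2, hD.map_comulRestrict]
    exact Coalgebra.coassoc_apply (x : C)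
  rTensor_counit_comp_comul := by
    ext x
    apply Module.Flat.lTensor_preserves_injective_linearMap (M := k) _ D.injective_subtype
    have h : ∀ t : D ⊗[k] D, D.subtype.lTensor k
        ((Coalgebra.counit ∘ₗ D.subtype : D →ₗ[k] k).rTensor D t) =
        Coalgebra.counit.rTensor C (TensorProduct.map D.subtype D.subtype t) := by
      intro t
      induction t with
      | zero => simp
      | add a b ha hb => simp only [map_add, ha, hb]
      | tmul a b => simp
    simp only [LinearMap.comp_apply, h, hD.map_comulRestrict]
    simp
  lTensor_counit_comp_comul := by
    ext x
    apply Module.Flat.rTensor_preserves_injective_linearMap (M := k) _ D.injective_subtype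
    have h : ∀ t : D ⊗[k] D, D.subtype.rTensor k
        ((Coalgebra.counit ∘ₗ D.subtype : D →ₗ[k] k).lTensor D t) =
        Coalgebra.counit.lTensor C (TensorProduct.map D.subtype D.subtype t) := by
      intro t
      induction t with
      | zero => simp
      | add a b ha hb => simp only [map_add, ha, hb]
      | tmul a b => simp
    simp only [LinearMap.comp_apply, h, hD.map_comulRestrict]
    simp

variable {H : Type*} [Ring H] [Bialgebra k H]

/-- A subalgebra that is also a subcoalgebra is a bialgebra with the restricted operations. -/
abbrev subBialgebra (S : Subalgebra k H) (hS : IsSubcoalgebra k (Subalgebra.toSubmodule S)) :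
    Bialgebra k S :=
  letI : Coalgebra k S := hS.coalgebra
  have key : ∀ x : S, Algebra.TensorProduct.map S.val S.val (Coalgebra.comul x) =
      Coalgebra.comul (x : H) := fun x => hS.map_comulRestrict x
  have hinj : Function.Injective (Algebra.TensorProduct.map S.val S.val) :=
    map_subtype_injective (Subalgebra.toSubmodule S)
  Bialgebra.mk' k S
    (Bialgebra.counit_one (R := k) (A := H))
    (fun {a b} => Bialgebra.counit_mul (R := k) (a : H) (b : H))
    (hinj (by rw [key, map_one]; exact Bialgebra.comul_one))
    (fun {a b} => hinj (by
      rw [map_mul (Algebra.TensorProduct.map S.val S.val), key, key, key]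
      exact Bialgebra.comul_mul (a : H) (b : H)))

end SubBialgebra

section Coradical

variable {k C : Type*} [Field k] [AddCommGroup C] [Module k C] [Coalgebra k C]

variable (k C) in
lemma isSubcoalgebra_coradical : IsSubcoalgebra k (coradical k C) := by
  have h : coradical k C ≤
      (tensorSub k (coradical k C) (coradical k C)).comap Coalgebra.comul := by
    refine sSup_le fun D hD x hx => ?_
    have hle : D ≤ coradical k C := le_sSup hD
    exact tensorSub_mono hle hle (hD.1 x hx)
  exact h

lemma isSimpleSubcoalgebra_span {g : C} (hg : IsGroupLikeElem k g) :
    IsSimpleSubcoalgebra k (Submodule.span k {g}) := by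
  refine ⟨?_, ?_, ?_⟩
  · intro x hx
    obtain ⟨c, rfl⟩ := Submodule.mem_span_singleton.1 hx
    rw [map_smul, hg.comul_eq_tmul_self]
    refine Submodule.smul_mem _ _ ⟨⟨g, Submodule.mem_span_singleton_self g⟩ ⊗ₜ
      ⟨g, Submodule.mem_span_singleton_self g⟩, ?_⟩
    simp
  · simpa using hg.ne_zero
  · intro E hE _
    exact (nonzero_span_atom g hg.ne_zero).le_iff.1 hE

lemma exists_isGroupLikeElem_of_finrank_eq_one {D : Submodule k C} (hD : IsSubcoalgebra k D)
    (h1 : Module.finrank k D = 1) : ∃ g : C, IsGroupLikeElem k g ∧ D = Submodule.span k {g} := by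
  obtain ⟨v, hv0, hv⟩ := finrank_eq_one_iff'.1 h1
  have hx0 : (v : C) ≠ 0 := fun h => hv0 (Subtype.ext h)
  have hspan : D = Submodule.span k {(v : C)} := by
    apply le_antisymm
    · intro x hx
      obtain ⟨c, hc⟩ := hv ⟨x, hx⟩
      exact Submodule.mem_span_singleton.2 ⟨c, congrArg Subtype.val hc⟩
    · exact (Submodule.span_singleton_le_iff_mem _ _).2 v.2
  have hten : tensorSub k D D ≤ Submodule.span k {(v : C) ⊗ₜ[k] (v : C)} := by
    rintro _ ⟨t, rfl⟩
    induction t with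
    | zero => simp
    | add a b ha hb => rw [map_add]; exact Submodule.add_mem _ ha hb
    | tmul a b =>
      obtain ⟨c, rfl⟩ := hv a
      obtain ⟨d, rfl⟩ := hv b
      refine Submodule.mem_span_singleton.2 ⟨c * d, ?_⟩
      rw [TensorProduct.smul_tmul_smul, map_smul]
      rfl
  obtain ⟨c, hc⟩ := Submodule.mem_span_singleton.1 (hten (hD v v.2))
  have hce : c * Coalgebra.counit (R := k) (v : C) = 1 := by
    have h := Coalgebra.rTensor_counit_comul (R := k) (v : C)
    rw [← hc] at h
    have h2 := congrArg (TensorProduct.lid k C) h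
    simp only [map_smul, LinearMap.rTensor_tmul, TensorProduct.lid_tmul, one_smul,
      smul_smul] at h2
    exact smul_left_injective k hx0 (by simpa using h2)
  have hc0 : c ≠ 0 := left_ne_zero_of_mul_eq_one hce
  refine ⟨c • (v : C), ⟨by simpa using hce, ?_⟩, ?_⟩
  · rw [map_smul, ← hc, TensorProduct.smul_tmul_smul, smul_smul]
  · exact hspan.trans (Submodule.span_singleton_smul_eq (IsUnit.mk0 c hc0) _).symm

/-- The coradical of a pointed coalgebra is spanned by the group-like elements. -/
lemma IsPointed.coradical_eq_span (h : IsPointed k C) :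
    coradical k C = Submodule.span k {g : C | IsGroupLikeElem k g} := by
  apply le_antisymm
  · refine sSup_le fun D hD => ?_
    obtain ⟨g, hg, rfl⟩ := exists_isGroupLikeElem_of_finrank_eq_one hD.1 (h D hD)
    exact Submodule.span_mono (Set.singleton_subset_iff.2 hg)
  · refine Submodule.span_le.2 fun g hg => ?_
    have hle : Submodule.span k {g} ≤ coradical k C := le_sSup (isSimpleSubcoalgebra_span hg)
    exact hle (Submodule.mem_span_singleton_self g)

variable {H : Type*} [Ring H] [Bialgebra k H]

/-- The coradical `H₀` of a pointed bialgebra `H`, which is a subalgebra of `H`. -/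
def coradicalSubalgebra (h : IsPointed k H) : Subalgebra k H :=
  (coradical k H).toSubalgebra
    (by
      rw [h.coradical_eq_span]
      exact Submodule.subset_span IsGroupLikeElem.one)
    (by
      intro x y hx hy
      rw [h.coradical_eq_span] at hx hy ⊢
      have hxy := Submodule.mul_mem_mul hx hy
      rw [Submodule.span_mul_span] at hxy
      refine Submodule.span_mono ?_ hxy
      rintro _ ⟨a, ha, b, hb, rfl⟩
      exact IsGroupLikeElem.mul ha hb)

/-- The coradical `H₀` of a pointed bialgebra `H`, as a bialgebra with the operations of `H`. -/
instance coradicalBialgebra (h : IsPointed k H) : Bialgebra k (coradicalSubalgebra h) :=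
  subBialgebra (coradicalSubalgebra h) (isSubcoalgebra_coradical k H)

end Coradical

end PointedHopf

end

/-! The Hopf power `[m]` is the `m`-th convolution power of the identity in the algebra of linear
maps `H → H`, whose unit is `u ∘ ε` (`toConv_hopfPower`). Group-like elements are linearly
independent, hence form a finite group; they span `H₀`, and `[m] g = g ^ m`, so `d = exp(H₀)` is
finite. The map `[d] - u ∘ ε` vanishes on `H₀`, so its `(n + 1)`-st convolution power vanishes on
`Hₙ = H` (`conv_pow_eq_zero`). If `p ^ N > n`, then since the unit commutes with everything,
Frobenius gives `0 = ([d] - u ∘ ε) ^ (p ^ N) = [d * p ^ N] - u ∘ ε`. The choice `N = ⌊log_p n⌋ + 1`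
gives the bound. -/

open scoped TensorProduct

namespace PointedHopf

/-! ### Nilpotency and Frobenius in the convolution algebra -/

section Convolution

variable {k C A : Type*} [Field k] [AddCommGroup C] [Module k C] [Coalgebra k C]
  [Ring A] [Algebra k A]

/-- The convolution product of a map vanishing on `U` and a map vanishing on `V` vanishes on the
wedge of `U` and `V`. -/
lemma conv_mul_apply_eq_zero_of_mem_wedge {U V : Submodule k C} {f g : WithConv (C →ₗ[k] A)}
    (hf : ∀ x ∈ U, f x = 0) (hg : ∀ x ∈ V, g x = 0) {x : C} (hx : x ∈ wedge k U V) :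
    (f * g) x = 0 := by
  -- The value of `f * g` at `x` is the product map applied to `(f ⊗ g)(Δ x)`, and `f ⊗ g` kills
  -- both `U ⊗ C` and `C ⊗ V`.
  have key : tensorSub k U ⊤ ⊔ tensorSub k ⊤ V ≤
      LinearMap.ker (LinearMap.mul' k A ∘ₗ TensorProduct.map f.ofConv g.ofConv) := by
    refine sup_le ?_ ?_ <;> rintro _ ⟨t, rfl⟩ <;> rw [LinearMap.mem_ker] <;>
      induction t with
      | zero => simp
      | add a b ha hb => rw [map_add, map_add, ha, hb, add_zero]
      | tmul a b => first | simp [hf a a.2] | simp [hg b b.2]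
  exact key hx

/-- The `(n + 1)`-st convolution power of a map vanishing on the coradical vanishes on the `n`-th
term of the coradical filtration. -/
lemma conv_pow_succ_apply_eq_zero {f : WithConv (C →ₗ[k] A)}
    (hf : ∀ x ∈ coradical k C, f x = 0) (n : ℕ) :
    ∀ x ∈ coradicalFiltration k C n, (f ^ (n + 1)) x = 0 := by
  induction n with
  | zero => simpa [coradicalFiltration] using hf
  | succ n ih =>
    intro x hx
    -- The new factor is split off on the left, matching `Cₙ₊₁ = C₀ ∧ Cₙ`.
    rw [pow_succ']
    exact conv_mul_apply_eq_zero_of_mem_wedge hf ih hx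

lemma conv_pow_eq_zero {f : WithConv (C →ₗ[k] A)} (hf : ∀ x ∈ coradical k C, f x = 0) {n : ℕ}
    (hn : coradicalFiltration k C n = ⊤) : f ^ (n + 1) = 0 :=
  WithConv.ext <| LinearMap.ext fun x => conv_pow_succ_apply_eq_zero hf n x (hn ▸ trivial)

/-- In characteristic `p`, a map which agrees with the convolution unit on the coradical of a
coalgebra `C = Cₙ` has trivial `p ^ N`-th convolution power as soon as `n < p ^ N`. -/
lemma conv_pow_char_pow_eq_one (p : ℕ) [Fact p.Prime] [CharP k p] {f : WithConv (C →ₗ[k] A)}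
    (hf : ∀ x ∈ coradical k C, f x = algebraMap k A (Coalgebra.counit x)) {n N : ℕ}
    (hn : coradicalFiltration k C n = ⊤) (hN : n < p ^ N) : f ^ p ^ N = 1 := by
  -- The zero algebra does not have characteristic `p`, so it is treated apart.
  rcases subsingleton_or_nontrivial (WithConv (C →ₗ[k] A)) with _ | _
  · exact Subsingleton.elim _ _
  have := charP_of_injective_algebraMap (algebraMap k (WithConv (C →ₗ[k] A))).injective p
  have h0 : (f - 1) ^ p ^ N = 0 :=
    pow_eq_zero_of_le hN <| conv_pow_eq_zero (fun x hx => by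
      rw [WithConv.ofConv_sub, LinearMap.sub_apply, hf x hx]; exact sub_self _) hn
  rwa [sub_pow_char_pow_of_commute _ _ (Commute.one_right f), one_pow, sub_eq_zero] at h0

end Convolution

/-! ### Hopf powers as convolution powers -/

section HopfPower

variable (k H : Type*) [Field k] [Ring H] [Bialgebra k H]

/-- Multiplicative counterpart of the recursion defining `iterComul`: on pure tensors, appending an
entry on the right multiplies the product by it on the right. -/
lemma iterMul_mulEquiv_tmul (n : ℕ) (t : ⨂[k]^n H) (x : H) :
    iterMul k H (n + 1) (TensorPower.mulEquiv
      (t ⊗ₜ[k] (PiTensorProduct.subsingletonEquiv (R := k) (0 : Fin 1)).symm x)) =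
      iterMul k H n t * x := by
  induction t using PiTensorProduct.induction_on with
  | add a b ha hb => simp only [TensorProduct.add_tmul, map_add, ha, hb, add_mul]
  | smul_tprod r a =>
    have h1 : (PiTensorProduct.subsingletonEquiv (R := k) (0 : Fin 1)).symm x =
        PiTensorProduct.tprod k (fun _ : Fin 1 => x) := by
      rw [LinearEquiv.symm_apply_eq]; simp
    have h2 := TensorPower.tprod_mul_tprod k a (fun _ : Fin 1 => x)
    rw [TensorPower.gMul_def] at h2
    rw [← TensorProduct.smul_tmul', map_smul, map_smul, map_smul, h1, h2, smul_mul_assoc]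
    congr 1
    rw [iterMul, iterMul, PiTensorProduct.lift.tprod, PiTensorProduct.lift.tprod,
      MultilinearMap.mkPiAlgebraFin_apply, MultilinearMap.mkPiAlgebraFin_apply,
      Fin.append_right_eq_snoc, List.ofFn_succ_last]
    simp

/-- The `n`-th Hopf power is the `n`-th convolution power of the identity. -/
lemma toConv_hopfPower (n : ℕ) :
    WithConv.toConv (hopfPower k H n) = WithConv.toConv (LinearMap.id : H →ₗ[k] H) ^ n := by
  induction n with
  | zero =>
    ext x
    simp [hopfPower, iterMul, iterComul, Algebra.algebraMap_eq_smul_one]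
  | succ n ih =>
    rw [pow_succ, ← ih]
    ext x
    have h : ∀ t : H ⊗[k] H, iterMul k H (n + 1) (TensorPower.mulEquiv (TensorProduct.map
          (iterComul k H n) (PiTensorProduct.subsingletonEquiv (0 : Fin 1)).symm.toLinearMap t)) =
        LinearMap.mul' k H (TensorProduct.map (hopfPower k H n) LinearMap.id t) := by
      intro t
      induction t with
      | zero => simp
      | add a b ha hb => simp only [map_add, ha, hb]
      | tmul a b => exact iterMul_mulEquiv_tmul k H n _ b
    exact h _

lemma hopfPowerTrivial_iff_conv_pow_eq_one (n : ℕ) :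
    HopfPowerTrivial k H n ↔ WithConv.toConv (LinearMap.id : H →ₗ[k] H) ^ n = 1 := by
  rw [← toConv_hopfPower]
  exact ⟨fun h => WithConv.ext <| LinearMap.ext h,
    fun h x => LinearMap.congr_fun (congrArg WithConv.ofConv h) x⟩

/-- This recursion lets later inductions avoid tensor powers. -/
lemma hopfPower_succ_apply (n : ℕ) (x : H) : hopfPower k H (n + 1) x =
    LinearMap.mul' k H (TensorProduct.map (hopfPower k H n) LinearMap.id (Coalgebra.comul x)) := by
  have h := toConv_hopfPower k H (n + 1)
  rw [pow_succ, ← toConv_hopfPower] at h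
  exact LinearMap.congr_fun (congrArg WithConv.ofConv h) x

lemma hopfPower_zero_apply (x : H) :
    hopfPower k H 0 x = algebraMap k H (Coalgebra.counit x) :=
  LinearMap.congr_fun (congrArg WithConv.ofConv (toConv_hopfPower k H 0)) x

variable {k H}

lemma hopfPower_isGroupLikeElem {g : H} (hg : IsGroupLikeElem k g) (n : ℕ) :
    hopfPower k H n g = g ^ n := by
  induction n with
  | zero => simp [hopfPower_zero_apply, hg.counit_eq_one]
  | succ n ih => simp [hopfPower_succ_apply, hg.comul_eq_tmul_self, ih, pow_succ]

/-- Bialgebra homomorphisms commute with Hopf powers. -/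
lemma map_hopfPower {B : Type*} [Ring B] [Bialgebra k B] (φ : B →ₐc[k] H) (n : ℕ) (x : B) :
    φ (hopfPower k B n x) = hopfPower k H n (φ x) := by
  induction n generalizing x with
  | zero =>
    rw [hopfPower_zero_apply, hopfPower_zero_apply, CoalgHomClass.counit_comp_apply]
    exact AlgHomClass.commutes φ _
  | succ n ih =>
    rw [hopfPower_succ_apply, hopfPower_succ_apply, ← CoalgHomClass.map_comp_comul_apply]
    generalize (Coalgebra.comul x : B ⊗[k] B) = t
    induction t with
    | zero => simp
    | add a b ha hb => simp only [map_add, ha, hb]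
    | tmul a b => simp [ih]

lemma hopfExponent_le {n : ℕ} (hn : 0 < n) (h : HopfPowerTrivial k H n) :
    hopfExponent k H ≤ n :=
  iInf₂_le n ⟨hn, h⟩

/-- A bialgebra with some trivial Hopf power has finite exponent, and the exponent is attained. -/
lemma exists_hopfExponent_eq (h : ∃ n, 0 < n ∧ HopfPowerTrivial k H n) :
    ∃ d : ℕ, 0 < d ∧ HopfPowerTrivial k H d ∧ hopfExponent k H = d := by
  classical
  obtain ⟨h0, h1⟩ := Nat.find_spec h
  exact ⟨Nat.find h, h0, h1, le_antisymm (hopfExponent_le h0 h1)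
    (le_iInf₂ fun m hm => by exact_mod_cast Nat.find_min' h hm)⟩

end HopfPower

/-! ### Exponent of the coradical and conclusion -/

section Coradical

variable {k H : Type*} [Field k] [Ring H]

/-- The inclusion of the coradical of a pointed bialgebra, as a bialgebra homomorphism. -/
noncomputable def coradicalInclusion [Bialgebra k H] (h : IsPointed k H) : coradicalSubalgebra h →ₐc[k] H :=
  BialgHom.ofAlgHom (coradicalSubalgebra h).val rfl
    (AlgHom.ext (isSubcoalgebra_coradical k H).map_comulRestrict)

/-- The inclusion of `H₀` is an injective bialgebra map, so the Hopf powers of `H₀` are the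
restrictions of those of `H`. -/
lemma hopfPowerTrivial_coradical_iff [Bialgebra k H] (h : IsPointed k H) (n : ℕ) :
    HopfPowerTrivial k (coradicalSubalgebra h) n ↔
      ∀ x ∈ coradical k H, hopfPower k H n x = algebraMap k H (Coalgebra.counit x) := by
  refine ⟨fun hn x hx => ?_, fun hn x => Subtype.ext ?_⟩
  · rw [← show coradicalInclusion h ⟨x, hx⟩ = x from rfl, ← map_hopfPower, hn]
    rfl
  · exact (map_hopfPower (coradicalInclusion h) n x).trans (hn x x.2)

lemma hopfPowerTrivial_coradical_of_forall_pow_eq_one [Bialgebra k H] (h : IsPointed k H) {n : ℕ}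
    (hn : ∀ g : H, IsGroupLikeElem k g → g ^ n = 1) :
    HopfPowerTrivial k (coradicalSubalgebra h) n := by
  rw [hopfPowerTrivial_coradical_iff, h.coradical_eq_span]
  intro x hx
  induction hx using Submodule.span_induction with
  | mem g hg =>
    rw [hopfPower_isGroupLikeElem hg, hn g hg, IsGroupLikeElem.counit_eq_one hg, map_one]
  | zero => simp
  | add x y _ _ hx hy => simp only [map_add, hx, hy]
  | smul c x _ hx => rw [map_smul, hx, map_smul, smul_eq_mul, map_mul, Algebra.smul_def]

lemma finite_groupLike [HopfAlgebra k H] [FiniteDimensional k H] : Finite (GroupLike k H) :=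
  have : Finite {a : H // IsGroupLikeElem k a} :=
    (linearIndepOn_isGroupLikeElem (R := k) (A := H)).finite
  Finite.of_equiv _ GroupLike.valEquiv.symm

/-- The coradical of a finite-dimensional pointed Hopf algebra has finite exponent. -/
lemma exists_hopfPowerTrivial_coradical [HopfAlgebra k H] [FiniteDimensional k H]
    (h : IsPointed k H) : ∃ n, 0 < n ∧ HopfPowerTrivial k (coradicalSubalgebra h) n := by
  have := finite_groupLike (k := k) (H := H)
  -- The antipode makes the group-like elements a group, so each is killed by the order of this
  -- finite group.
  refine ⟨Nat.card (GroupLike k H), Nat.card_pos,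
    hopfPowerTrivial_coradical_of_forall_pow_eq_one h fun g hg => ?_⟩
  exact congrArg GroupLike.val (pow_card_eq_one' (x := (⟨g, hg⟩ : GroupLike k H)))

/-- In characteristic `p`, triviality of the `d`-th Hopf power on the coradical of `H = Hₙ` implies
triviality of the `d * p ^ N`-th Hopf power on `H` whenever `n < p ^ N`. -/
lemma hopfPowerTrivial_mul_pow [Bialgebra k H] (h : IsPointed k H) (p : ℕ) [Fact p.Prime]
    [CharP k p] {d n N : ℕ} (hd : HopfPowerTrivial k (coradicalSubalgebra h) d)
    (hn : coradicalFiltration k H n = ⊤) (hN : n < p ^ N) :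
    HopfPowerTrivial k H (d * p ^ N) := by
  -- Here `id ^ (d * p ^ N)` becomes `[d] ^ (p ^ N)`, and `[d]` agrees with the unit on `H₀`.
  rw [hopfPowerTrivial_iff_conv_pow_eq_one, pow_mul, ← toConv_hopfPower]
  exact conv_pow_char_pow_eq_one p ((hopfPowerTrivial_coradical_iff h d).1 hd) hn hN

end Coradical

end PointedHopf

theorem theorem5p1 {k H : Type*} [Field k] [Ring H] [HopfAlgebra k H] [FiniteDimensional k H]
    (p : ℕ) (hp : 0 < p) [CharP k p]
    (hpt : PointedHopf.IsPointed k H)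
    (n : ℕ) (hn : 0 < n) (hH : PointedHopf.coradicalFiltration k H n = ⊤) :
    PointedHopf.hopfExponent k (PointedHopf.coradicalSubalgebra hpt) < ⊤ ∧
    PointedHopf.hopfExponent k H ≤
      PointedHopf.hopfExponent k (PointedHopf.coradicalSubalgebra hpt) *
        ((p ^ (Nat.log p n + 1) : ℕ) : ℕ∞) ∧
    PointedHopf.hopfExponent k H < ⊤ := by
  have hprime : Fact p.Prime :=
    ⟨(CharP.char_is_prime_or_zero k p).resolve_right hp.ne'⟩
  obtain ⟨d, hd0, hd, hexp⟩ :=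
    PointedHopf.exists_hopfExponent_eq (PointedHopf.exists_hopfPowerTrivial_coradical hpt)
  have hle := PointedHopf.hopfExponent_le (Nat.mul_pos hd0 (pow_pos hp (Nat.log p n + 1)))
    (PointedHopf.hopfPowerTrivial_mul_pow hpt p hd hH
      (Nat.lt_pow_succ_log_self hprime.out.one_lt n))
  rw [hexp]
  exact ⟨ENat.natCast_lt_top d, by exact_mod_cast hle, hle.trans_lt (ENat.natCast_lt_top _)⟩
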